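/- Let $A\in\mathbb{R}^{n\times n}$ be an entrywise nonnegative irreducible matrix such that $A+A^T$ is primitive (some positive power of it has only positive entries). Let $f:\mathbb{R}^n\to\mathbb{R}^n$, \[ f(x)=\tfrac12\left(\log(A^Te^x)-\log(Ae^{-x})\right), \] where $\log$ and $\exp$ act entrywise. Then there exists $v\in\mathbb{R}^n$ such that $f(v)=v$ and $B=\mathrm{diag}(e^v)\,A\,\mathrm{diag}(e^v)^{-1}$ is balanced (for every $i$, the $i$-th row sum of $B$ equals its $i$-th column sum), and such that, with \[ P=\tfrac12\left(\mathrm{diag}(A^Te^v)^{-1}A^T\mathrm{diag}(e^v)+\mathrm{diag}(Ae^{-v})^{-1}A\,\mathrm{diag}(e^{-v})\right), \qquad |\lambda_2(P)|=\max\{|\lambda| : \lambda\in\mathrm{spectrum}(P)\subset\mathbb{C},\ \lambda\neq1\} \] (the maximum being read as $0$ if there is no such $\lambda$), the following hold. 1. $P$ is the Jacobian matrix of $f$ at $v$. 2. For every $x\in\mathbb{R}^n$ there is a constant $c\in\mathbb{R}$ such that, for every norm (or seminorm) $\|\cdot\|$ on $\mathbb{R}^n$, \[ \limsup_{k\to\infty}\|f^{k+1}(x)-(v+c\mathbf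 1)\|^{1/k}\le|\lambda_2(P)|, \] where $f^{k}$ is the $k$-th iterate of $f$ and $\mathbf 1=(1,\dots,1)$. 3. The ideal HOTS algorithm converges linearly at rate $|\lambda_2(P)|$: $|\lambda_2(P)|<1$, and for every $y^0\in\mathbb{R}^n$ with positive entries there is $c\in\mathbb{R}$ such that the iterates \[ y_i^{k+1}=\left(\frac{\sum_{j}A_{ji}\,y_j^k}{\sum_{l}A_{il}\,(y_l^k)^{-1}}\right)^{1/2} \] converge to $y^*=e^{v+c\mathbf 1}$ and satisfy $\limsup_{k\to\infty}\|y^k-y^*\|^{1/k}\le|\lambda_2(P)|$ for every norm (or seminorm) on $\mathbb{R}^n$. -/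

import Mathlib

open Filter Topology
open scoped Matrix

noncomputable section

namespace Hots

variable {n : ℕ}

/-- Entrywise exponential of a vector. -/
def expVec (x : Fin n → ℝ) : Fin n → ℝ := fun i => Real.exp (x i)

/-- The map `f(x) = ½ (log (Aᵀ eˣ) - log (A e⁻ˣ))`, with `log` and `exp` acting entrywise. -/
def idealMap (A : Matrix (Fin n) (Fin n) ℝ) (x : Fin n → ℝ) : Fin n → ℝ :=
  fun i => (1 / 2) * (Real.log ((Aᵀ *ᵥ expVec x) i) - Real.log ((A *ᵥ expVec (-x)) i))

/-- One step of the ideal HOTS algorithm: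
`y_i ↦ ((∑_j A_{ji} y_j) / (∑_l A_{il} y_l⁻¹)) ^ (1/2)`. -/
def idealStep (A : Matrix (Fin n) (Fin n) ℝ) (y : Fin n → ℝ) : Fin n → ℝ :=
  fun i => ((∑ j, A j i * y j) / (∑ l, A i l * (y l)⁻¹)) ^ (1 / 2 : ℝ)

/-- The matrix
`P = ½ (diag(Aᵀ eᵛ)⁻¹ Aᵀ diag(eᵛ) + diag(A e⁻ᵛ)⁻¹ A diag(e⁻ᵛ))`. -/
def rateMatrix (A : Matrix (Fin n) (Fin n) ℝ) (v : Fin n → ℝ) : Matrix (Fin n) (Fin n) ℝ :=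
  (1 / 2 : ℝ) •
    ((Matrix.diagonal (Aᵀ *ᵥ expVec v))⁻¹ * Aᵀ * Matrix.diagonal (expVec v) +
      (Matrix.diagonal (A *ᵥ expVec (-v)))⁻¹ * A * Matrix.diagonal (expVec (-v)))

/-- The moduli of the complex eigenvalues of `P` other than `1`. -/
def otherModuli (P : Matrix (Fin n) (Fin n) ℝ) : Set ℝ :=
  {r | ∃ z ∈ spectrum ℂ (P.map (algebraMap ℝ ℂ)), z ≠ 1 ∧ r = ‖z‖}

/-- `|λ₂(P)| = max {|λ| : λ ∈ spectrum P, λ ≠ 1}`; it is `0` when there is no such `λ`. -/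
def absLambda2 (P : Matrix (Fin n) (Fin n) ℝ) : ℝ := sSup (otherModuli P)

/-- The supremum defining `|λ₂(P)|` is a maximum as soon as the set is nonempty. -/
theorem isGreatest_absLambda2 (P : Matrix (Fin n) (Fin n) ℝ) (h : (otherModuli P).Nonempty) :
    IsGreatest (otherModuli P) (absLambda2 P) := by
  have hfin : (otherModuli P).Finite := by
    refine ((Matrix.finite_spectrum (P.map (algebraMap ℝ ℂ))).image (fun z => ‖z‖)).subset ?_
    rintro r ⟨z, hz, -, rfl⟩
    exact ⟨z, hz, rfl⟩
  exact ⟨h.csSup_mem hfin, fun r hr => le_csSup hfin.bddAbove hr⟩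

/-- A square matrix is balanced if its `i`-th row sum equals its `i`-th column sum for all `i`. -/
def IsBalanced (B : Matrix (Fin n) (Fin n) ℝ) : Prop :=
  ∀ i, ∑ j, B i j = ∑ j, B j i

/-- The sequence `u` converges linearly to `l` at rate `r`: `r < 1`, `u k → l`, and
`limsup ‖u k - l‖ ^ (1/k) ≤ r` for every norm (every seminorm, in fact) on `ℝⁿ`. The `limsup` is
taken in `[0, ∞]`. -/
def ConvergesLinearlyTo (u : ℕ → Fin n → ℝ) (l : Fin n → ℝ) (r : ℝ) : Prop :=
  r < 1 ∧ Tendsto u atTop (𝓝 l) ∧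
    ∀ N : Seminorm ℝ (Fin n → ℝ),
      limsup (fun k : ℕ => ENNReal.ofReal (N (u k - l)) ^ (1 / (k : ℝ))) atTop ≤ ENNReal.ofReal r

end Hots

end

/-! The map `f` is topical (monotone, commuting with constants), hence nonexpansive in the sup norm.
A balancing vector `v` is a minimizer of `∑ A i j * exp (x i - x j)`, which exists by
irreducibility; balance makes `v` a fixed point of `f`.

Global convergence: `max (x i - v i)` never increases along orbits, and primitivity of `A + Aᵀ`
makes some iterate of `f` strictly decrease it off `v + const`. Orbits stay bounded, so each
converges to some `v + c`.

Rate: let `B` be the balanced matrix and `d` its row sums. Then `d i * P i j = (B i j + B j i) / 2`,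
so the stochastic matrix `P` is reversible, hence diagonalizable over the reals. It is primitive
along with `A + Aᵀ`, so only constants belong to eigenvalues of modulus 1. The largest
eigen-coordinate off the eigenvalue 1 is a seminorm that `P` contracts by `|λ₂|`. Linearizing `f` at
`v` modulo constants gives decay at every rate `s > |λ₂|`; the topical property upgrades this to
decay in norm. The HOTS iteration is `f` conjugated by `exp`. -/

namespace Hots

/-! ### Root rates and seminorm bounds -/

theorem limsup_rpow_one_div_le_of_geometric {a : ℕ → ℝ} {r : ℝ} (hr : 0 ≤ r)
    (h : ∀ s > r, ∃ C : ℝ, ∀ᶠ k in atTop, a k ≤ C * s ^ k) :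
    limsup (fun k : ℕ => ENNReal.ofReal (a k) ^ (1 / (k : ℝ))) atTop ≤ ENNReal.ofReal r := by
  refine ENNReal.le_of_forall_pos_le_add fun ε hε _ => ?_
  have hε' : (0 : ℝ) < ε := hε
  obtain ⟨C, hC⟩ := h (r + ε / 2) (by linarith)
  have hs : 0 < r + (ε : ℝ) / 2 := by linarith
  have ht : 0 < r + (ε : ℝ) := by linarith
  -- The gap between `r + ε / 2` and `r + ε` absorbs the constant `C` for large `k`.
  have hlim : Tendsto (fun k : ℕ => C * ((r + ε / 2) / (r + ε)) ^ k) atTop (𝓝 (C * 0)) :=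
    (tendsto_pow_atTop_nhds_zero_of_lt_one (by positivity)
      ((div_lt_one ht).2 (by linarith))).const_mul C
  rw [mul_zero] at hlim
  have hle : ENNReal.ofReal r + ε = ENNReal.ofReal (r + ε) := by
    rw [ENNReal.ofReal_add hr ε.coe_nonneg, ENNReal.ofReal_coe_nnreal]
  rw [hle]
  refine limsup_le_of_le (by isBoundedDefault) ?_
  filter_upwards [hC, hlim.eventually (gt_mem_nhds zero_lt_one), eventually_gt_atTop 0]
    with k hk hk1 hk0
  have hak : a k ≤ (r + ε) ^ k := by
    rw [div_pow, mul_div_assoc', div_lt_one (by positivity)] at hk1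
    linarith
  calc ENNReal.ofReal (a k) ^ (1 / (k : ℝ))
      ≤ (ENNReal.ofReal ((r + ε) ^ k)) ^ (1 / (k : ℝ)) := by gcongr
    _ = ENNReal.ofReal (r + ε) := by
      rw [ENNReal.ofReal_pow ht.le, ← ENNReal.rpow_natCast, ← ENNReal.rpow_mul,
        mul_one_div_cancel (by exact_mod_cast hk0.ne'), ENNReal.rpow_one]

variable {ι : Type*} [Fintype ι]

theorem exists_seminorm_le_mul_norm (N : Seminorm ℝ (ι → ℝ)) :
    ∃ C : ℝ, 0 ≤ C ∧ ∀ x, N x ≤ C * ‖x‖ := by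
  classical
  refine ⟨∑ i, N (Pi.single i 1), Finset.sum_nonneg fun i _ => apply_nonneg N _, fun x => ?_⟩
  have hx : x = ∑ i, x i • Pi.single i (1 : ℝ) := by
    ext j; simp [Finset.sum_apply, Pi.single_apply]
  calc N x = N (∑ i, x i • Pi.single i (1 : ℝ)) := by rw [← hx]
    _ ≤ ∑ i, N (x i • Pi.single i (1 : ℝ)) :=
      Finset.le_sum_of_subadditive N (map_zero N).le (map_add_le_add N) _ _
    _ ≤ ∑ i, N (Pi.single i 1) * ‖x‖ := by
      refine Finset.sum_le_sum fun i _ => ?_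
      rw [map_smul_eq_mul, mul_comm]
      exact mul_le_mul_of_nonneg_left (norm_le_pi_norm x i) (apply_nonneg N _)
    _ = _ := by rw [Finset.sum_mul]

/-! ### Topical maps: convergence of orbits and its rate -/

theorem le_add_norm_sub (x y : ι → ℝ) : x ≤ y + fun _ => ‖x - y‖ := fun i => by
  have := (le_abs_self _).trans (norm_le_pi_norm (x - y) i)
  simp only [Pi.sub_apply] at this
  simp only [Pi.add_apply]; linarith

/-- A self-map of `ℝ^ι` is a topical map if it is monotone and commutes with the addition of
constant vectors. -/
structure IsTopical (f : (ι → ℝ) → ι → ℝ) : Prop where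
  monotone : Monotone f
  add_const : ∀ x (c : ℝ), f (x + fun _ => c) = f x + fun _ => c

namespace IsTopical

variable {f : (ι → ℝ) → ι → ℝ}

theorem norm_sub_le (hf : IsTopical f) (x y : ι → ℝ) : ‖f x - f y‖ ≤ ‖x - y‖ := by
  have h1 : f x ≤ f y + fun _ => ‖x - y‖ := by
    rw [← hf.add_const]; exact hf.monotone (le_add_norm_sub x y)
  have h2 : f y ≤ f x + fun _ => ‖x - y‖ := by
    rw [← hf.add_const, norm_sub_rev]; exact hf.monotone (le_add_norm_sub y x)
  refine (pi_norm_le_iff_of_nonneg (norm_nonneg _)).2 fun i => ?_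
  have h1 := h1 i
  have h2 := h2 i
  simp only [Pi.add_apply] at h1 h2
  rw [Real.norm_eq_abs, abs_le, Pi.sub_apply]
  constructor <;> linarith

theorem continuous (hf : IsTopical f) : Continuous f :=
  (LipschitzWith.of_dist_le_mul (K := 1) fun x y => by
    simpa [dist_eq_norm] using hf.norm_sub_le x y).continuous

omit [Fintype ι] in
theorem iterate (hf : IsTopical f) (k : ℕ) : IsTopical f^[k] := by
  refine ⟨hf.monotone.iterate k, fun x c => ?_⟩
  induction k with
  | zero => rfl
  | succ k ih => rw [Function.iterate_succ_apply', ih, hf.add_const, Function.iterate_succ_apply']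

variable {v : ι → ℝ}

omit [Fintype ι] in
theorem iterate_fixed_add_const (hf : IsTopical f) (hv : f v = v) (k : ℕ) (c : ℝ) :
    f^[k] (v + fun _ => c) = v + fun _ => c := by
  rw [(hf.iterate k).add_const, Function.iterate_fixed hv]

/-- A topical map with a fixed point, some iterate of which is strongly monotone, has all its orbits
convergent. -/
theorem exists_tendsto_iterate [Nonempty ι] (hf : IsTopical f) (hv : f v = v) {K : ℕ}
    (hK : ∀ x y, x ≤ y → x ≠ y → ∀ i, f^[K] x i < f^[K] y i) (x : ι → ℝ) :
    ∃ c : ℝ, Tendsto (fun k => f^[k] x) atTop (𝓝 (v + fun _ => c)) := by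
  -- `M y` is the least `c` with `y ≤ v + c`; it serves as a Lyapunov function.
  set M : (ι → ℝ) → ℝ := fun y => Finset.univ.sup' Finset.univ_nonempty fun i => y i - v i with hM
  have hMc : Continuous M :=
    Continuous.finset_sup'_apply _ fun i _ => (continuous_apply i).sub continuous_const
  have hleM : ∀ y, y ≤ v + fun _ => M y := fun y i => by
    have := Finset.le_sup' (fun i => y i - v i) (Finset.mem_univ i)
    simp only [Pi.add_apply]
    change y i - v i ≤ M y at this
    linarith
  have hMle : ∀ y c, y ≤ (v + fun _ => c) → M y ≤ c := fun y c h =>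
    Finset.sup'_le _ _ fun i _ => by
      have := h i
      simp only [Pi.add_apply] at this
      linarith
  have hMlt : ∀ y c, (∀ i, y i < v i + c) → M y < c := fun y c h =>
    (Finset.sup'_lt_iff _).2 fun i _ => by have := h i; linarith
  have hMf : ∀ k y, M (f^[k] y) ≤ M y := fun k y => by
    refine hMle _ _ ?_
    rw [← hf.iterate_fixed_add_const hv k]
    exact (hf.iterate k).monotone (hleM y)
  have hball : ∀ k, f^[k] x ∈ Metric.closedBall v ‖x - v‖ := fun k => by
    rw [mem_closedBall_iff_norm]
    have := (hf.iterate k).norm_sub_le x v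
    rwa [Function.iterate_fixed hv] at this
  obtain ⟨z, -, φ, hφ, hz⟩ := (isCompact_closedBall v ‖x - v‖).tendsto_subseq hball
  have hanti : Antitone fun k => M (f^[k] x) := antitone_nat_of_succ_le fun k => by
    rw [Function.iterate_succ_apply']; exact hMf 1 _
  have hMz : Tendsto (fun k => M (f^[k] x)) atTop (𝓝 (M z)) := by
    refine (tendsto_iff_tendsto_subseq_of_antitone hanti hφ.tendsto_atTop).2 ?_
    exact (hMc.tendsto z).comp hz
  -- Both sides are limits of the same convergent sequence, taken along subsequences.
  have hMz' : M (f^[K] z) = M z := by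
    have h1 : Tendsto (fun k => M (f^[K] (f^[φ k] x))) atTop (𝓝 (M (f^[K] z))) :=
      ((hMc.comp (hf.iterate K).continuous).tendsto z).comp hz
    refine tendsto_nhds_unique h1 ?_
    have : (fun k => M (f^[K] (f^[φ k] x))) = (fun k => M (f^[k] x)) ∘ fun k => K + φ k := by
      ext k; simp [Function.iterate_add_apply]
    rw [this]
    exact hMz.comp (tendsto_atTop_mono (fun k => Nat.le_add_left _ _) hφ.tendsto_atTop)
  have hzv : z = v + fun _ => M z := by
    by_contra hne
    have h := hK z _ (hleM z) hne
    rw [hf.iterate_fixed_add_const hv] at h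
    exact (hMlt _ _ h).ne hMz'
  refine ⟨M z, ?_⟩
  rw [← hzv, tendsto_iff_norm_sub_tendsto_zero]
  have hfz : ∀ k, f^[k] z = z := fun k => by
    rw [hzv]; exact hf.iterate_fixed_add_const hv k _
  -- Distances to the fixed point `z` are nonincreasing, so convergence along `φ` suffices.
  refine (tendsto_iff_tendsto_subseq_of_antitone (antitone_nat_of_succ_le fun k => ?_)
    hφ.tendsto_atTop).2 (tendsto_iff_norm_sub_tendsto_zero.1 hz)
  rw [Function.iterate_succ_apply']
  have := hf.norm_sub_le (f^[k] x) z
  rwa [show f z = z from hfz 1] at this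

/-- If an orbit of a topical map converges to `l = v + c`, its distance to `l` is at most twice its
distance to any translate of `l` by a constant. -/
theorem norm_iterate_sub_le (hf : IsTopical f) [Nonempty ι] (hv : f v = v) {x : ι → ℝ} {c : ℝ}
    (hx : Tendsto (fun k => f^[k] x) atTop (𝓝 (v + fun _ => c))) (k : ℕ) (t : ℝ) :
    ‖f^[k] x - (v + fun _ => c)‖ ≤ 2 * ‖f^[k] x - (v + fun _ => c) - fun _ => t‖ := by
  set l := v + fun _ : ι => c with hl
  set r := ‖f^[k] x - l - fun _ => t‖ with hr
  obtain ⟨i⟩ := ‹Nonempty ι›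
  have hx' : Tendsto (fun m => f^[m] (f^[k] x) i) atTop (𝓝 (l i)) := by
    have := (tendsto_pi_nhds.1 hx i).comp (tendsto_add_atTop_nat k)
    refine this.congr fun m => ?_
    simp [Function.iterate_add_apply]
  have hfix : ∀ m (s : ℝ), f^[m] (l + fun _ => s) = l + fun _ => s := fun m s => by
    rw [(hf.iterate m).add_const, hl, hf.iterate_fixed_add_const hv]
  have hpt : ∀ j, |f^[k] x j - l j - t| ≤ r := fun j =>
    norm_le_pi_norm (f^[k] x - l - fun _ => t) j
  -- The translates `l + (t ± r)` are fixed and enclose the orbit from time `k` on, so they enclose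
  -- its limit `l`. Hence `|t| ≤ r`, which yields the factor 2.
  have hup : 0 ≤ t + r := by
    have hle : f^[k] x ≤ l + fun _ => t + r := fun j => by
      have := (abs_le.1 (hpt j)).2
      simp only [Pi.add_apply]; linarith
    have : l i ≤ l i + (t + r) := le_of_tendsto hx' <| Eventually.of_forall fun m => by
      have := (hf.iterate m).monotone hle i
      rwa [hfix] at this
    linarith
  have hlow : t - r ≤ 0 := by
    have hle : (l + fun _ => t - r) ≤ f^[k] x := fun j => by
      have := (abs_le.1 (hpt j)).1
      simp only [Pi.add_apply]; linarith
    have : l i + (t - r) ≤ l i := ge_of_tendsto hx' <| Eventually.of_forall fun m => by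
      have := (hf.iterate m).monotone hle i
      rwa [hfix] at this
    linarith
  refine (pi_norm_le_iff_of_nonneg (by positivity)).2 fun j => ?_
  have := abs_le.1 (hpt j)
  rw [Real.norm_eq_abs, abs_le, Pi.sub_apply]
  constructor <;> linarith

/-- Linear rate of convergence of an orbit of a topical map, from a contraction estimate of the
derivative in a seminorm that measures the distance to the constants. -/
theorem exists_norm_iterate_sub_le_geometric [Nonempty ι] (hf : IsTopical f) (hv : f v = v)
    {L : (ι → ℝ) →L[ℝ] ι → ℝ} (hL : HasFDerivAt f L v) {q : Seminorm ℝ (ι → ℝ)} {C r : ℝ}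
    (hr : 0 ≤ r) (hq : ∀ x, q (L x) ≤ r * q x) (hC : 0 ≤ C) (hq1 : q (fun _ => 1) = 0)
    (hqC : ∀ x, ∃ t : ℝ, ‖x - fun _ => t‖ ≤ C * q x) {x : ι → ℝ} {c : ℝ}
    (hx : Tendsto (fun k => f^[k] x) atTop (𝓝 (v + fun _ => c))) {s : ℝ} (hs : r < s) :
    ∃ D : ℝ, ∀ᶠ k in atTop, ‖f^[k] x - (v + fun _ => c)‖ ≤ D * s ^ k := by
  obtain ⟨E, hE0, hE⟩ := exists_seminorm_le_mul_norm q
  have hqc : ∀ t : ℝ, q (fun _ => t) = 0 := fun t => by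
    have : (fun _ : ι => t) = t • fun _ : ι => (1 : ℝ) := by ext; simp
    rw [this, map_smul_eq_mul, hq1, mul_zero]
  have hq_add : ∀ y (t : ℝ), q (y + fun _ => t) = q y := fun y t => by
    refine le_antisymm ((map_add_le_add q _ _).trans (by rw [hqc, add_zero])) ?_
    have := map_sub_le_add q (y + fun _ => t) (fun _ => t)
    rwa [add_sub_cancel_right, hqc, add_zero] at this
  have hs0 : 0 < s := hr.trans_lt hs
  set l := v + fun _ : ι => c with hl
  set w : ℕ → ι → ℝ := fun k => f^[k] x - l with hw
  have hw0 : Tendsto (fun k => ‖w k‖) atTop (𝓝 0) := tendsto_iff_norm_sub_tendsto_zero.1 hx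
  have hqw : Tendsto (fun k => C * q (w k)) atTop (𝓝 0) := by
    have h2 : Tendsto (fun k => C * (E * ‖w k‖)) atTop (𝓝 0) := by
      simpa using (hw0.const_mul E).const_mul C
    refine squeeze_zero (fun k => mul_nonneg hC (apply_nonneg q _)) (fun k => ?_) h2
    exact mul_le_mul_of_nonneg_left (hE _) hC
  -- The linearization error `ε` is chosen to fit in the gap `s - r`; the `+ 1` guards against `E *
  -- C = 0`.
  obtain ⟨ε, hε, hεs⟩ : ∃ ε > 0, r + E * (ε * C) ≤ s := by
    refine ⟨(s - r) / (E * C + 1), div_pos (by linarith) (by positivity), ?_⟩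
    have : E * ((s - r) / (E * C + 1) * C) = (s - r) * (E * C / (E * C + 1)) := by
      ring
    rw [this]
    have h1 : E * C / (E * C + 1) ≤ 1 := (div_le_one (by positivity)).2 (by linarith)
    nlinarith
  have ho := hasFDerivAt_iff_isLittleO_nhds_zero.1 hL
  obtain ⟨δ, hδ, hball⟩ := Metric.eventually_nhds_iff.1 (ho.def hε)
  have hstep : ∀ᶠ k in atTop, q (w (k + 1)) ≤ s * q (w k) := by
    filter_upwards [hqw.eventually (gt_mem_nhds hδ)] with k hk
    -- Removing the constant `t` bounds the norm of the remainder `u` by `C * q (w k)`. Since `f`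
    -- commutes with constants, the expansion at `v` still applies.
    obtain ⟨t, ht⟩ := hqC (w k)
    set u := w k - fun _ => t with hu
    have hwu : w k = u + fun _ => t := by rw [hu]; abel
    have hk1 := hball (y := u) (by rw [dist_zero_right]; exact ht.trans_lt hk)
    set ρ := f (v + u) - f v - L u with hρ
    have hnext : w (k + 1) = (L u + ρ) + fun _ => t := by
      have h1 : f^[k] x = (v + u) + fun _ => c + t := by
        have : f^[k] x = w k + l := by simp [hw]
        rw [this, hwu, hl]; ext i; simp; ring
      have : w (k + 1) = f (f^[k] x) - l := by simp only [hw, Function.iterate_succ_apply']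
      rw [this, h1, hf.add_const, hρ, hl, hv]
      ext i; simp; ring
    calc q (w (k + 1)) = q (L u + ρ) := by rw [hnext, hq_add]
      _ ≤ q (L u) + q ρ := map_add_le_add q _ _
      _ ≤ r * q u + E * ‖ρ‖ := add_le_add (hq u) (hE ρ)
      _ ≤ r * q u + E * (ε * ‖u‖) := by gcongr
      _ ≤ r * q u + E * (ε * (C * q (w k))) := by gcongr
      _ = (r + E * (ε * C)) * q (w k) := by rw [hwu, hq_add]; ring
      _ ≤ s * q (w k) := by gcongr
  obtain ⟨k₀, hk₀⟩ := eventually_atTop.1 hstep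
  have hgeo : ∀ m, q (w (k₀ + m)) ≤ s ^ m * q (w k₀) := fun m => by
    induction m with
    | zero => simp
    | succ m ih =>
      calc q (w (k₀ + m + 1)) ≤ s * q (w (k₀ + m)) := hk₀ _ (Nat.le_add_right _ _)
        _ ≤ s * (s ^ m * q (w k₀)) := by gcongr
        _ = _ := by ring
  refine ⟨2 * (C * (q (w k₀) / s ^ k₀)), eventually_atTop.2 ⟨k₀, fun k hk => ?_⟩⟩
  obtain ⟨m, rfl⟩ := Nat.exists_eq_add_of_le hk
  obtain ⟨t, ht⟩ := hqC (w (k₀ + m))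
  calc ‖w (k₀ + m)‖ ≤ 2 * ‖w (k₀ + m) - fun _ => t‖ := hf.norm_iterate_sub_le hv hx _ t
    _ ≤ 2 * (C * (s ^ m * q (w k₀))) := by
      gcongr; exact ht.trans (mul_le_mul_of_nonneg_left (hgeo m) hC)
    _ = _ := by rw [pow_add]; field_simp

end IsTopical

end Hots

namespace Hots

/-! ### Spectra of stochastic and reversible matrices -/

section Stochastic

variable {ι : Type*} [Fintype ι] [DecidableEq ι] {P : Matrix ι ι ℝ}

theorem pow_mulVec_eq_smul {u : ι → ℝ} {μ : ℝ} (h : P *ᵥ u = μ • u) (k : ℕ) :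
    (P ^ k) *ᵥ u = μ ^ k • u := by
  induction k with
  | zero => simp
  | succ k ih =>
    rw [pow_succ, ← Matrix.mulVec_mulVec, h, Matrix.mulVec_smul, ih, smul_smul, pow_succ']

omit [DecidableEq ι] in
theorem abs_eigenvalue_le_one (hP : ∀ i j, 0 ≤ P i j) (h1 : P *ᵥ 1 = 1) {u : ι → ℝ} {μ : ℝ}
    (hu : u ≠ 0) (h : P *ᵥ u = μ • u) : |μ| ≤ 1 := by
  have hle : ‖P *ᵥ u‖ ≤ ‖u‖ := by
    refine (pi_norm_le_iff_of_nonneg (norm_nonneg _)).2 fun i => ?_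
    have h1i : ∑ j, P i j = 1 := by simpa [Matrix.mulVec, dotProduct] using congrFun h1 i
    calc ‖∑ j, P i j * u j‖ ≤ ∑ j, ‖P i j * u j‖ := norm_sum_le _ _
      _ ≤ ∑ j, P i j * ‖u‖ := Finset.sum_le_sum fun j _ => by
        rw [norm_mul, Real.norm_of_nonneg (hP i j)]
        exact mul_le_mul_of_nonneg_left (norm_le_pi_norm u j) (hP i j)
      _ = ‖u‖ := by rw [← Finset.sum_mul, h1i, one_mul]
  rw [h, norm_smul, Real.norm_eq_abs] at hle
  exact (mul_le_iff_le_one_left (norm_pos_iff.2 hu)).1 hle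

omit [DecidableEq ι] in
theorem eq_const_of_pos_mulVec_eq_self [Nonempty ι] (hP : ∀ i j, 0 < P i j) (h1 : P *ᵥ 1 = 1)
    {u : ι → ℝ} (h : P *ᵥ u = u) : ∃ t : ℝ, u = fun _ => t := by
  obtain ⟨i, hi⟩ := Finite.exists_max u
  refine ⟨u i, ?_⟩
  have h1i : ∑ j, P i j = 1 := by simpa [Matrix.mulVec, dotProduct] using congrFun h1 i
  have hui : ∑ j, P i j * u j = u i := congrFun h i
  -- At a maximal coordinate `u i` is a weighted mean of values at most `u i`, with all weights
  -- positive.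
  have h0 : ∑ j, P i j * (u i - u j) = 0 := by
    simp_rw [mul_sub, Finset.sum_sub_distrib, ← Finset.sum_mul, h1i, hui, one_mul, sub_self]
  ext j
  have := (Finset.sum_eq_zero_iff_of_nonneg fun j _ =>
    mul_nonneg (hP i j).le (sub_nonneg.2 (hi j))).1 h0 j (Finset.mem_univ _)
  rcases mul_eq_zero.1 this with h | h
  · exact absurd h (hP i j).ne'
  · linarith

theorem eq_const_of_mulVec_eq_smul [Nonempty ι] (hP : P.IsPrimitive) (h1 : P *ᵥ 1 = 1)
    {u : ι → ℝ} {μ : ℝ} (hμ : |μ| = 1) (h : P *ᵥ u = μ • u) : ∃ t : ℝ, u = fun _ => t := by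
  obtain ⟨k, hk, hpos⟩ := hP.exists_pos_pow
  -- The even exponent turns `μ = -1` into the eigenvalue 1.
  refine eq_const_of_pos_mulVec_eq_self (P := P ^ (k * 2)) ?_ ?_ ?_
  · intro i j
    rw [pow_mul, pow_two, Matrix.mul_apply]
    exact Finset.sum_pos (fun l _ => mul_pos (hpos i l) (hpos l j)) Finset.univ_nonempty
  · simpa using pow_mulVec_eq_smul (μ := 1) (by rwa [one_smul]) (k * 2)
  · have hμ2 : μ ^ 2 = 1 := by rw [← sq_abs, hμ, one_pow]
    rw [pow_mulVec_eq_smul h, mul_comm, pow_mul, hμ2, one_pow, one_smul]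

/-- A matrix satisfying detailed balance with respect to positive weights is diagonalizable, with
real eigenvalues. -/
theorem exists_eigenbasis_of_reversible {d : ι → ℝ} (hd : ∀ i, 0 < d i)
    (hrev : ∀ i j, d i * P i j = d j * P j i) :
    ∃ (b : Module.Basis ι ℝ (ι → ℝ)) (μ : ι → ℝ), (∀ i, P *ᵥ b i = μ i • b i) ∧
      ∀ z : ℂ, z ∈ spectrum ℂ (P.map (algebraMap ℝ ℂ)) ↔ ∃ i, z = μ i := by
  set s : ι → ℝ := fun i => √(d i) with hs
  have hs0 : ∀ i, 0 < s i := fun i => Real.sqrt_pos.2 (hd i)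
  have hsd : ∀ i, d i = s i * s i := fun i => (Real.mul_self_sqrt (hd i).le).symm
  -- Detailed balance says exactly that conjugating `P` by `diag(√d)` gives a symmetric matrix.
  set S : Matrix ι ι ℝ := Matrix.diagonal s * P * Matrix.diagonal s⁻¹ with hSdef
  have hSij : ∀ i j, S i j = s i * P i j * (s j)⁻¹ := fun i j => by
    simp [hSdef, Matrix.mul_diagonal, Matrix.diagonal_mul]
  have hS : S.IsHermitian := Matrix.IsHermitian.ext fun i j => by
    have h := hrev i j
    rw [hsd, hsd] at h
    have hi := (hs0 i).ne'
    have hj := (hs0 j).ne'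
    simp only [hSij, star_trivial]
    field_simp
    linarith
  have hinv : Matrix.diagonal s⁻¹ * Matrix.diagonal s = 1 := by
    rw [Matrix.diagonal_mul_diagonal, ← Matrix.diagonal_one]
    congr 1; ext i; simp [(hs0 i).ne']
  have hchar : S.charpoly = P.charpoly := by
    rw [hSdef, Matrix.charpoly_mul_comm, ← mul_assoc, hinv, one_mul]
  let e : EuclideanSpace ℝ ι ≃ₗ[ℝ] (ι → ℝ) := (WithLp.linearEquiv 2 ℝ (ι → ℝ)).trans
    (LinearEquiv.piCongrRight fun i => LinearEquiv.smulOfNeZero ℝ ℝ (s i)⁻¹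
      (inv_ne_zero (hs0 i).ne'))
  refine ⟨hS.eigenvectorBasis.toBasis.map e, hS.eigenvalues, fun i => ?_, fun z => ?_⟩
  · have hb : hS.eigenvectorBasis.toBasis.map e i =
        Matrix.diagonal s⁻¹ *ᵥ ⇑(hS.eigenvectorBasis i) := by
      ext j; simp [e, Matrix.mulVec_diagonal]
    have hPS : P * Matrix.diagonal s⁻¹ = Matrix.diagonal s⁻¹ * S := by
      rw [hSdef, ← mul_assoc, ← mul_assoc, hinv, one_mul]
    rw [hb, Matrix.mulVec_mulVec, hPS, ← Matrix.mulVec_mulVec, hS.mulVec_eigenvectorBasis,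
      Matrix.mulVec_smul]
  · rw [Matrix.mem_spectrum_iff_isRoot_charpoly, Matrix.charpoly_map, ← hchar, hS.charpoly_eq]
    simp [Polynomial.map_prod, Polynomial.eval_prod, Finset.prod_eq_zero_iff, sub_eq_zero]

end Stochastic

/-! ### Contraction modulo constants -/

section Rate

variable {n : ℕ} {P : Matrix (Fin n) (Fin n) ℝ}

theorem absLambda2_nonneg (P : Matrix (Fin n) (Fin n) ℝ) : 0 ≤ absLambda2 P :=
  Real.sSup_nonneg fun _ ⟨_, _, _, hr⟩ => hr ▸ norm_nonneg _

/-- A reversible primitive stochastic matrix contracts, by the factor `|λ₂| < 1`, a seminorm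
measuring the distance to the constants. -/
theorem absLambda2_contraction [NeZero n] (hP : P.IsPrimitive) (h1 : P *ᵥ 1 = 1)
    {d : Fin n → ℝ} (hd : ∀ i, 0 < d i) (hrev : ∀ i j, d i * P i j = d j * P j i) :
    absLambda2 P < 1 ∧ ∃ (q : Seminorm ℝ (Fin n → ℝ)) (C : ℝ), 0 ≤ C ∧ q (fun _ => 1) = 0 ∧
      (∀ x, q (P *ᵥ x) ≤ absLambda2 P * q x) ∧ ∀ x, ∃ t : ℝ, ‖x - fun _ => t‖ ≤ C * q x := by
  obtain ⟨b, μ, hb, hspec⟩ := exists_eigenbasis_of_reversible hd hrev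
  have hconst : ∀ i, |μ i| = 1 → ∃ t : ℝ, b i = fun _ => t := fun i hi =>
    eq_const_of_mulVec_eq_smul hP h1 hi (hb i)
  have hlt : ∀ i, μ i ≠ 1 → |μ i| < 1 := fun i hi => by
    refine (abs_eigenvalue_le_one hP.nonneg h1 (b.ne_zero i) (hb i)).lt_of_ne fun h => hi ?_
    obtain ⟨t, ht⟩ := hconst i h
    have hbi := hb i
    have ht1 : b i = t • 1 := by rw [ht]; ext; simp
    rw [ht1, Matrix.mulVec_smul, h1, ← ht1] at hbi
    have h0 : (μ i - 1) • b i = 0 := by rw [sub_smul, one_smul, ← hbi, sub_self]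
    rcases smul_eq_zero.1 h0 with h | h
    · linarith
    · exact absurd h (b.ne_zero i)
  have hle : ∀ i, μ i ≠ 1 → |μ i| ≤ absLambda2 P := fun i hi => by
    have hmem : |μ i| ∈ otherModuli P :=
      ⟨μ i, (hspec _).2 ⟨i, rfl⟩, by exact_mod_cast hi, by simp⟩
    exact (isGreatest_absLambda2 P ⟨_, hmem⟩).2 hmem
  refine ⟨?_, ?_⟩
  · rcases (otherModuli P).eq_empty_or_nonempty with h | h
    -- Here `sSup ∅ = 0`.
    · simp [absLambda2, h]
    · obtain ⟨z, hz, hz1, hr⟩ := (isGreatest_absLambda2 P h).1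
      obtain ⟨i, rfl⟩ := (hspec z).1 hz
      rw [hr, Complex.norm_real]
      exact hlt i (by exact_mod_cast hz1)
  have hrepr : ∀ x i, b.repr (P *ᵥ x) i = μ i * b.repr x i := fun x i => by
    have h : b.coord i ∘ₗ P.mulVecLin = μ i • b.coord i := b.ext fun j => by
      simp only [LinearMap.comp_apply, Matrix.mulVecLin_apply, hb, map_smul, LinearMap.smul_apply,
        Module.Basis.coord_apply, Module.Basis.repr_self, smul_eq_mul]
      rcases eq_or_ne j i with rfl | hji
      · rfl
      · simp [hji]
    exact LinearMap.congr_fun h x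
  -- `T` drops the eigen-coordinates for the eigenvalue 1, whose eigenvectors are constant.
  let T : (Fin n → ℝ) →ₗ[ℝ] Fin n → ℝ := LinearMap.pi fun i => if μ i = 1 then 0 else b.coord i
  have hT1 : ∀ x i, μ i = 1 → T x i = 0 := fun x i hi => by simp [T, hi]
  have hT2 : ∀ x i, μ i ≠ 1 → T x i = b.repr x i := fun x i hi => by simp [T, hi]
  refine ⟨(normSeminorm ℝ (Fin n → ℝ)).comp T, ∑ i, ‖b i‖,
    Finset.sum_nonneg fun i _ => norm_nonneg _, ?_, fun x => ?_, fun x => ?_⟩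
  · rw [Seminorm.comp_apply, coe_normSeminorm, norm_eq_zero]
    ext i
    by_cases hi : μ i = 1
    · exact hT1 _ _ hi
    · rw [hT2 _ _ hi]
      have := hrepr 1 i
      rw [h1] at this
      have h0 : (μ i - 1) * b.repr 1 i = 0 := by linarith
      exact (mul_eq_zero.1 h0).resolve_left (sub_ne_zero.2 hi)
  · simp only [Seminorm.comp_apply, coe_normSeminorm]
    refine (pi_norm_le_iff_of_nonneg (mul_nonneg (absLambda2_nonneg P) (norm_nonneg _))).2
      fun i => ?_
    by_cases hi : μ i = 1
    · rw [hT1 _ _ hi, norm_zero]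
      exact mul_nonneg (absLambda2_nonneg P) (norm_nonneg _)
    · rw [hT2 _ _ hi, hrepr, ← hT2 _ _ hi, norm_mul]
      exact mul_le_mul (hle i hi) (norm_le_pi_norm _ i) (norm_nonneg _) (absLambda2_nonneg P)
  · simp only [Seminorm.comp_apply, coe_normSeminorm]
    have hex : ∀ i, ∃ t : ℝ, b.repr x i • b i = T x i • b i + fun _ => t := fun i => by
      by_cases hi : μ i = 1
      · obtain ⟨t, ht⟩ := hconst i (by rw [hi, abs_one])
        exact ⟨b.repr x i * t, by rw [hT1 _ _ hi, ht]; ext; simp⟩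
      · exact ⟨0, by rw [hT2 _ _ hi]; ext; simp⟩
    choose t ht using hex
    refine ⟨∑ i, t i, ?_⟩
    have hx : (x - fun _ => ∑ i, t i) = ∑ i, T x i • b i := by
      conv_lhs => rw [← b.sum_repr x]
      simp_rw [ht, Finset.sum_add_distrib]
      ext j
      simp [Finset.sum_apply]
    rw [hx, Finset.sum_mul]
    refine (norm_sum_le _ _).trans (Finset.sum_le_sum fun i _ => ?_)
    rw [norm_smul, mul_comm]
    exact mul_le_mul_of_nonneg_left (norm_le_pi_norm _ i) (norm_nonneg _)

end Rate

end Hots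

namespace Hots

/-! ### Positivity patterns and diagonal balancing -/

section Matrices

variable {ι : Type*} [Fintype ι] [DecidableEq ι] {A : Matrix ι ι ℝ}

theorem exists_pos_entry_of_isIrreducible (hA : A.IsIrreducible) (i : ι) : ∃ j, 0 < A i j := by
  obtain ⟨k, hk, hpos⟩ := (Matrix.isIrreducible_iff_exists_pow_pos hA.nonneg).1 hA i i
  obtain ⟨k, rfl⟩ := Nat.exists_eq_succ_of_ne_zero hk.ne'
  by_contra! h
  have h0 : ∀ j, A i j = 0 := fun j => le_antisymm (h j) (hA.nonneg i j)
  rw [pow_succ', Matrix.mul_apply] at hpos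
  simp [h0] at hpos

theorem pow_succ_pos_iff (hA : ∀ i j, 0 ≤ A i j) (k : ℕ) (i j : ι) :
    0 < (A ^ (k + 1)) i j ↔ ∃ l, 0 < A i l ∧ 0 < (A ^ k) l j := by
  have hk : ∀ l, 0 ≤ (A ^ k) l j := fun l => Matrix.pow_apply_nonneg hA k l j
  rw [pow_succ', Matrix.mul_apply,
    Finset.sum_pos_iff_of_nonneg fun l _ => mul_nonneg (hA i l) (hk l)]
  simp only [Finset.mem_univ, true_and]
  refine exists_congr fun l => ⟨fun h => ⟨?_, ?_⟩, fun h => mul_pos h.1 h.2⟩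
  · exact (hA i l).lt_of_ne fun h0 => by simp [← h0] at h
  · exact (hk l).lt_of_ne fun h0 => by simp [← h0] at h

/-- Positive entries of a power correspond to walks, and each walk for `A` is also one for `B`. -/
theorem pow_pos_of_pos_imp {B : Matrix ι ι ℝ} (hA : ∀ i j, 0 ≤ A i j) (hB : ∀ i j, 0 ≤ B i j)
    (h : ∀ i j, 0 < A i j → 0 < B i j) (k : ℕ) (i j : ι) (hk : 0 < (A ^ k) i j) :
    0 < (B ^ k) i j := by
  induction k generalizing i with
  | zero => simpa using hk
  | succ k ih =>
    obtain ⟨l, h1, h2⟩ := (pow_succ_pos_iff hA k i j).1 hk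
    exact (pow_succ_pos_iff hB k i j).2 ⟨l, h i l h1, ih l h2⟩

/-- The function `x ↦ ∑ A_{ij} e^{x_i - x_j}` attains its minimum if `A` is irreducible. -/
theorem exists_min_sum_mul_exp_sub (hA : A.IsIrreducible) :
    ∃ v : ι → ℝ, ∀ x : ι → ℝ,
      ∑ i, ∑ j, A i j * Real.exp (v i - v j) ≤ ∑ i, ∑ j, A i j * Real.exp (x i - x j) := by
  rcases isEmpty_or_nonempty ι with hι | ⟨⟨i₀⟩⟩
  · exact ⟨0, fun x => by simp⟩
  set φ : (ι → ℝ) → ℝ := fun x => ∑ i, ∑ j, A i j * Real.exp (x i - x j) with hφ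
  have hterm : ∀ x i j, A i j * Real.exp (x i - x j) ≤ φ x := fun x i j => by
    have h0 : ∀ i j, 0 ≤ A i j * Real.exp (x i - x j) := fun i j =>
      mul_nonneg (hA.nonneg i j) (Real.exp_pos _).le
    exact (Finset.single_le_sum (f := fun j => A i j * Real.exp (x i - x j)) (fun j _ => h0 i j)
      (Finset.mem_univ j)).trans
      (Finset.single_le_sum (f := fun i => ∑ j, A i j * Real.exp (x i - x j))
        (fun i _ => Finset.sum_nonneg fun j _ => h0 i j) (Finset.mem_univ i))
  have hstep : ∃ L : ℝ, ∀ x, φ x ≤ φ 0 → ∀ i j, 0 < A i j → x i - x j ≤ L := by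
    -- Summing absolute values gives one bound for all edges; where `A i j = 0` the term is `|log 0|
    -- = 0`.
    refine ⟨∑ i, ∑ j, |Real.log (φ 0 / A i j)|, fun x hx i j hij => ?_⟩
    have hexp : Real.exp (x i - x j) ≤ φ 0 / A i j := by
      rw [le_div_iff₀ hij, mul_comm]; exact (hterm x i j).trans hx
    have hlog := Real.log_le_log (Real.exp_pos _) hexp
    rw [Real.log_exp] at hlog
    refine (hlog.trans (le_abs_self _)).trans ?_
    exact (Finset.single_le_sum (f := fun j => |Real.log (φ 0 / A i j)|)
      (fun j _ => abs_nonneg _) (Finset.mem_univ j)).trans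
      (Finset.single_le_sum (f := fun i => ∑ j, |Real.log (φ 0 / A i j)|)
        (fun i _ => Finset.sum_nonneg fun j _ => abs_nonneg _) (Finset.mem_univ i))
  obtain ⟨L, hL⟩ := hstep
  have hpath : ∀ x, φ x ≤ φ 0 → ∀ (k : ℕ) i j, 0 < (A ^ k) i j → x i - x j ≤ k * L := by
    intro x hx k
    induction k with
    | zero =>
      intro i j h
      have : i = j := by by_contra hne; simp [hne] at h
      simp [this]
    | succ k ih =>
      intro i j h
      obtain ⟨l, h1, h2⟩ := (pow_succ_pos_iff hA.nonneg k i j).1 h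
      have := hL x hx i l h1
      have := ih l j h2
      push_cast
      linarith
  have hex := (Matrix.isIrreducible_iff_exists_pow_pos hA.nonneg).1 hA
  choose κ _ hκ using hex
  set R : ι → ℝ := fun i => |κ i i₀ * L| + |κ i₀ i * L| with hR
  have hR0 : ∀ i, 0 ≤ R i := fun i => by positivity
  -- Paths in both directions between `i` and `i₀` confine the normalized sublevel set to a compact
  -- box.
  have hbox : ∀ x, φ x ≤ φ 0 → x i₀ = 0 → x ∈ Set.Icc (-R) R := fun x hx hx0 => by
    constructor <;> intro i
    · have h1 := hpath x hx _ _ _ (hκ i₀ i)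
      have h2 := le_abs_self (κ i₀ i * L)
      have h3 := abs_nonneg (κ i i₀ * L)
      simp only [hR, Pi.neg_apply]
      linarith
    · have h1 := hpath x hx _ _ _ (hκ i i₀)
      have h2 := le_abs_self (κ i i₀ * L)
      have h3 := abs_nonneg (κ i₀ i * L)
      simp only [hR]
      linarith
  have hcont : Continuous φ := by fun_prop
  have h0mem : (0 : ι → ℝ) ∈ Set.Icc (-R) R := ⟨fun i => by simpa using hR0 i, fun i => hR0 i⟩
  obtain ⟨v, -, hv⟩ := isCompact_Icc.exists_isMinOn ⟨0, h0mem⟩ hcont.continuousOn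
  refine ⟨v, fun x => ?_⟩
  change φ v ≤ φ x
  rcases le_total (φ 0) (φ x) with h | h
  · exact (hv h0mem).trans h
  · have hshift : φ (fun i => x i - x i₀) = φ x := by simp [hφ]
    rw [← hshift] at h ⊢
    exact hv (hbox _ h (by simp))

/-- An irreducible matrix can be balanced by a positive diagonal similarity. -/
theorem exists_balancing (hA : A.IsIrreducible) :
    ∃ v : ι → ℝ, ∀ i, ∑ j, A i j * Real.exp (v i - v j) = ∑ j, A j i * Real.exp (v j - v i) := by
  obtain ⟨v, hv⟩ := exists_min_sum_mul_exp_sub hA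
  refine ⟨v, fun k => ?_⟩
  -- The derivative at the minimizer along the `k`-th basis vector is the `k`-th row sum minus the
  -- `k`-th column sum.
  set h : ι → ℝ := Pi.single k 1 with hh
  set g : ℝ → ℝ := fun t => ∑ i, ∑ j, A i j * Real.exp ((v i + t * h i) - (v j + t * h j)) with hg
  have hder : HasDerivAt g (∑ i, ∑ j, A i j * (Real.exp (v i - v j) * (h i - h j))) 0 := by
    refine HasDerivAt.fun_sum fun i _ => HasDerivAt.fun_sum fun j _ => HasDerivAt.const_mul _ ?_
    have h1 : HasDerivAt (fun t : ℝ => (v i + t * h i) - (v j + t * h j)) (h i - h j) 0 := by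
      have hi := ((hasDerivAt_id (0 : ℝ)).mul_const (h i)).const_add (v i)
      have hj := ((hasDerivAt_id (0 : ℝ)).mul_const (h j)).const_add (v j)
      simpa using hi.fun_sub hj
    simpa using h1.exp
  have hmin : IsLocalMin g 0 := Eventually.of_forall fun t => by
    simpa [hg] using hv fun i => v i + t * h i
  have h0 := hmin.hasDerivAt_eq_zero hder
  have hsplit : ∀ i j, A i j * (Real.exp (v i - v j) * (h i - h j)) =
      A i j * Real.exp (v i - v j) * h i - A i j * Real.exp (v i - v j) * h j := fun i j => by ring
  simp_rw [hsplit, Finset.sum_sub_distrib] at h0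
  rw [Finset.sum_comm (f := fun i j => A i j * Real.exp (v i - v j) * h j)] at h0
  simp_rw [← Finset.sum_mul] at h0
  simp only [hh, Pi.single_apply, mul_ite, mul_one, mul_zero, Finset.sum_ite_eq',
    Finset.mem_univ, if_true] at h0
  linarith

end Matrices

/-! ### The ideal HOTS map: order, derivative, conjugacy -/

section IdealMap

variable {n : ℕ} {A : Matrix (Fin n) (Fin n) ℝ}

theorem expVec_pos (x : Fin n → ℝ) (i : Fin n) : 0 < expVec x i := Real.exp_pos _

theorem transpose_nonneg (hA : ∀ i j, 0 ≤ A i j) (i j : Fin n) : 0 ≤ Aᵀ i j := hA j i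

theorem mulVec_pos (hA : ∀ i j, 0 ≤ A i j) (hrow : ∀ i, ∃ j, 0 < A i j) {x : Fin n → ℝ}
    (hx : ∀ i, 0 < x i) (i : Fin n) : 0 < (A *ᵥ x) i := by
  obtain ⟨j, hj⟩ := hrow i
  exact Finset.sum_pos' (fun l _ => mul_nonneg (hA i l) (hx l).le)
    ⟨j, Finset.mem_univ _, mul_pos hj (hx j)⟩

theorem mulVec_mono (hA : ∀ i j, 0 ≤ A i j) {x y : Fin n → ℝ} (h : x ≤ y) : A *ᵥ x ≤ A *ᵥ y :=
  fun i => Finset.sum_le_sum (s := Finset.univ) fun j _ =>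
    mul_le_mul_of_nonneg_left (h j) (hA i j)

theorem mulVec_lt (hA : ∀ i j, 0 ≤ A i j) {x y : Fin n → ℝ} (h : x ≤ y) {i j : Fin n}
    (hij : 0 < A i j) (hj : x j < y j) : (A *ᵥ x) i < (A *ᵥ y) i :=
  Finset.sum_lt_sum (fun l _ => mul_le_mul_of_nonneg_left (h l) (hA i l))
    ⟨j, Finset.mem_univ _, mul_lt_mul_of_pos_left hj hij⟩

theorem expVec_mono : Monotone (expVec (n := n)) := fun _ _ h i => Real.exp_le_exp.2 (h i)

theorem expVec_add_const (x : Fin n → ℝ) (c : ℝ) :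
    expVec (x + fun _ => c) = Real.exp c • expVec x := by
  ext i; simp [expVec, Real.exp_add, mul_comm]

theorem isTopical_idealMap (hA : ∀ i j, 0 ≤ A i j) (hrow : ∀ i, ∃ j, 0 < A i j)
    (hcol : ∀ i, ∃ j, 0 < Aᵀ i j) : IsTopical (idealMap A) where
  monotone x y h i := by
    have h1 := Real.log_le_log (mulVec_pos (transpose_nonneg hA) hcol (expVec_pos x) i)
      (mulVec_mono (transpose_nonneg hA) (expVec_mono h) i)
    have h2 := Real.log_le_log (mulVec_pos hA hrow (expVec_pos (-y)) i)
      (mulVec_mono hA (expVec_mono (neg_le_neg h)) i)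
    simp only [idealMap]
    linarith
  add_const x c := by
    ext i
    have hneg : -(x + fun _ => c) = -x + fun _ => -c := by ext; simp; ring
    have h1 := (mulVec_pos (transpose_nonneg hA) hcol (expVec_pos x) i).ne'
    have h2 := (mulVec_pos hA hrow (expVec_pos (-x)) i).ne'
    simp only [idealMap, hneg, expVec_add_const, Matrix.mulVec_smul, Pi.smul_apply, smul_eq_mul,
      Pi.add_apply]
    rw [Real.log_mul (Real.exp_pos _).ne' h1, Real.log_mul (Real.exp_pos _).ne' h2, Real.log_exp,
      Real.log_exp]
    ring

/-- An edge of `A` makes the term in `A e⁻ˣ` strict, an edge of `Aᵀ` the term in `Aᵀ eˣ`; hence the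
graph of `A + Aᵀ` governs strictness. -/
theorem idealMap_lt (hA : ∀ i j, 0 ≤ A i j) (hrow : ∀ i, ∃ j, 0 < A i j)
    (hcol : ∀ i, ∃ j, 0 < Aᵀ i j) {x y : Fin n → ℝ} (h : x ≤ y) {i j : Fin n}
    (hij : 0 < (A + Aᵀ) i j) (hj : x j < y j) : idealMap A x i < idealMap A y i := by
  have h1 := mulVec_pos (transpose_nonneg hA) hcol (expVec_pos x) i
  have h2 := mulVec_pos hA hrow (expVec_pos (-y)) i
  have h1' := Real.log_le_log h1 (mulVec_mono (transpose_nonneg hA) (expVec_mono h) i)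
  have h2' := Real.log_le_log h2 (mulVec_mono hA (expVec_mono (neg_le_neg h)) i)
  simp only [idealMap]
  rcases (hA i j).lt_or_eq with h0 | h0
  · have := Real.log_lt_log h2 (mulVec_lt hA (expVec_mono (neg_le_neg h)) h0
      (Real.exp_lt_exp.2 (neg_lt_neg hj)))
    linarith
  · have hT : 0 < Aᵀ i j := by simpa [← h0] using hij
    have := Real.log_lt_log h1 (mulVec_lt (transpose_nonneg hA) (expVec_mono h) hT
      (Real.exp_lt_exp.2 hj))
    linarith

theorem iterate_idealMap_lt (hA : ∀ i j, 0 ≤ A i j) (hrow : ∀ i, ∃ j, 0 < A i j)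
    (hcol : ∀ i, ∃ j, 0 < Aᵀ i j) {x y : Fin n → ℝ} (h : x ≤ y) {j : Fin n} (hj : x j < y j)
    (k : ℕ) (i : Fin n) (hij : 0 < ((A + Aᵀ) ^ k) i j) :
    (idealMap A)^[k] x i < (idealMap A)^[k] y i := by
  induction k generalizing i with
  | zero =>
    have : i = j := by by_contra hne; simp [hne] at hij
    simpa [this] using hj
  | succ k ih =>
    obtain ⟨l, h1, h2⟩ := (pow_succ_pos_iff (fun i j => add_nonneg (hA i j) (hA j i)) k i j).1 hij
    rw [Function.iterate_succ_apply', Function.iterate_succ_apply']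
    exact idealMap_lt hA hrow hcol (((isTopical_idealMap hA hrow hcol).iterate k).monotone h) h1
      (ih l h2)

theorem diagonal_inv_of_pos {u : Fin n → ℝ} (hu : ∀ i, 0 < u i) :
    (Matrix.diagonal u)⁻¹ = Matrix.diagonal u⁻¹ := by
  refine Matrix.inv_eq_right_inv ?_
  rw [Matrix.diagonal_mul_diagonal, ← Matrix.diagonal_one]
  congr 1; ext i; simp [(hu i).ne']

theorem rateMatrix_apply (hA : ∀ i j, 0 ≤ A i j) (hrow : ∀ i, ∃ j, 0 < A i j)
    (hcol : ∀ i, ∃ j, 0 < Aᵀ i j) (v : Fin n → ℝ) (i j : Fin n) :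
    rateMatrix A v i j = (1 / 2) * (A j i * Real.exp (v j) / (Aᵀ *ᵥ expVec v) i +
      A i j * Real.exp (-v j) / (A *ᵥ expVec (-v)) i) := by
  rw [rateMatrix, diagonal_inv_of_pos (mulVec_pos (transpose_nonneg hA) hcol (expVec_pos v)),
    diagonal_inv_of_pos (mulVec_pos hA hrow (expVec_pos (-v)))]
  simp only [Matrix.smul_apply, Matrix.add_apply, Matrix.mul_diagonal, Matrix.diagonal_mul,
    smul_eq_mul, expVec, Pi.neg_apply, Pi.inv_apply, Matrix.transpose_apply]
  ring

theorem hasFDerivAt_idealMap (hA : ∀ i j, 0 ≤ A i j) (hrow : ∀ i, ∃ j, 0 < A i j)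
    (hcol : ∀ i, ∃ j, 0 < Aᵀ i j) (v : Fin n → ℝ) :
    HasFDerivAt (idealMap A)
      (LinearMap.toContinuousLinearMap (Matrix.toLin' (rateMatrix A v))) v := by
  rw [hasFDerivAt_pi']
  intro i
  have hp1 := mulVec_pos (transpose_nonneg hA) hcol (expVec_pos v) i
  have hp2 := mulVec_pos hA hrow (expVec_pos (-v)) i
  have hproj : ∀ j, HasFDerivAt (fun x : Fin n → ℝ => x j)
      (ContinuousLinearMap.proj (R := ℝ) (φ := fun _ : Fin n => ℝ) j) v :=
    fun j => hasFDerivAt_apply j v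
  have h1 : HasFDerivAt (fun x : Fin n → ℝ => (Aᵀ *ᵥ expVec x) i) _ v :=
    HasFDerivAt.fun_sum (u := Finset.univ) fun j _ => ((hproj j).exp.const_mul (Aᵀ i j))
  have h2 : HasFDerivAt (fun x : Fin n → ℝ => (A *ᵥ expVec (-x)) i) _ v :=
    HasFDerivAt.fun_sum (u := Finset.univ) fun j _ => ((hproj j).fun_neg.exp.const_mul (A i j))
  have h := ((h1.log hp1.ne').fun_sub (h2.log hp2.ne')).const_mul (1 / 2 : ℝ)
  refine h.congr_fderiv ?_
  ext w
  simp only [FunLike.coe_smul, FunLike.coe_sub, Pi.smul_apply,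
    Pi.sub_apply, FunLike.coe_sum, Finset.sum_apply, smul_eq_mul,
    ContinuousLinearMap.proj_apply, ContinuousLinearMap.coe_comp, Function.comp_apply,
    neg_apply, LinearMap.coe_toContinuousLinearMap', Matrix.toLin'_apply,
    Matrix.mulVec, dotProduct, rateMatrix_apply hA hrow hcol]
  simp only [Finset.mul_sum, ← Finset.sum_sub_distrib]
  refine Finset.sum_congr rfl fun j _ => ?_
  simp only [Matrix.transpose_apply]
  ring

theorem idealStep_expVec (hA : ∀ i j, 0 ≤ A i j) (hrow : ∀ i, ∃ j, 0 < A i j)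
    (hcol : ∀ i, ∃ j, 0 < Aᵀ i j) (x : Fin n → ℝ) :
    idealStep A (expVec x) = expVec (idealMap A x) := by
  ext i
  have h1 := mulVec_pos (transpose_nonneg hA) hcol (expVec_pos x) i
  have h2 := mulVec_pos hA hrow (expVec_pos (-x)) i
  have e1 : ∑ j, A j i * expVec x j = (Aᵀ *ᵥ expVec x) i := rfl
  have e2 : ∑ l, A i l * (expVec x l)⁻¹ = (A *ᵥ expVec (-x)) i := by
    simp [Matrix.mulVec, dotProduct, expVec, Real.exp_neg]
  rw [idealStep, e1, e2, Real.rpow_def_of_pos (div_pos h1 h2), Real.log_div h1.ne' h2.ne']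
  simp only [expVec, idealMap]
  congr 1; ring

end IdealMap

end Hots

namespace Hots

/-! ### The rate matrix at a balancing vector -/

section Balanced

variable {n : ℕ} {A : Matrix (Fin n) (Fin n) ℝ} {v : Fin n → ℝ}

theorem mulVec_expVec_neg (A : Matrix (Fin n) (Fin n) ℝ) (v : Fin n → ℝ) (i : Fin n) :
    (A *ᵥ expVec (-v)) i = Real.exp (-v i) * ∑ j, A i j * Real.exp (v i - v j) := by
  simp only [Matrix.mulVec, dotProduct, expVec, Finset.mul_sum, Pi.neg_apply]
  refine Finset.sum_congr rfl fun j _ => ?_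
  rw [mul_left_comm, ← Real.exp_add]
  congr 2; ring

theorem transpose_mulVec_expVec (A : Matrix (Fin n) (Fin n) ℝ) (v : Fin n → ℝ) (i : Fin n) :
    (Aᵀ *ᵥ expVec v) i = Real.exp (v i) * ∑ j, A j i * Real.exp (v j - v i) := by
  simp only [Matrix.mulVec, dotProduct, expVec, Finset.mul_sum, Matrix.transpose_apply]
  refine Finset.sum_congr rfl fun j _ => ?_
  rw [mul_left_comm, ← Real.exp_add]
  congr 2; ring

theorem isBalanced_of_sum_eq
    (hv : ∀ i, ∑ j, A i j * Real.exp (v i - v j) = ∑ j, A j i * Real.exp (v j - v i)) :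
    IsBalanced (Matrix.diagonal (expVec v) * A * (Matrix.diagonal (expVec v))⁻¹) := by
  have h : ∀ i j, (Matrix.diagonal (expVec v) * A * (Matrix.diagonal (expVec v))⁻¹) i j =
      A i j * Real.exp (v i - v j) := fun i j => by
    rw [diagonal_inv_of_pos (expVec_pos v), Matrix.mul_diagonal, Matrix.diagonal_mul]
    simp only [expVec, Pi.inv_apply, Real.exp_sub]
    ring
  intro i
  simpa only [h] using hv i

/-- With `v` factored out, the logarithms contain the column and row sums of the balanced matrix;
these cancel, leaving `(v i + v i) / 2`. -/
theorem idealMap_eq_self_of_sum_eq (hA : ∀ i j, 0 ≤ A i j) (hrow : ∀ i, ∃ j, 0 < A i j)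
    (hv : ∀ i, ∑ j, A i j * Real.exp (v i - v j) = ∑ j, A j i * Real.exp (v j - v i)) :
    idealMap A v = v := by
  ext i
  have h1 := mulVec_pos hA hrow (expVec_pos (-v)) i
  rw [mulVec_expVec_neg] at h1
  have hd := (pos_of_mul_pos_right h1 (Real.exp_pos _).le).ne'
  rw [idealMap, mulVec_expVec_neg, transpose_mulVec_expVec, ← hv i,
    Real.log_mul (Real.exp_pos _).ne' hd, Real.log_mul (Real.exp_pos _).ne' hd, Real.log_exp,
    Real.log_exp]
  ring

theorem rateMatrix_mulVec_one (hA : ∀ i j, 0 ≤ A i j) (hrow : ∀ i, ∃ j, 0 < A i j)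
    (hcol : ∀ i, ∃ j, 0 < Aᵀ i j) (v : Fin n → ℝ) : rateMatrix A v *ᵥ 1 = 1 := by
  ext i
  have h1 := (mulVec_pos hA hrow (expVec_pos (-v)) i).ne'
  have h2 := (mulVec_pos (transpose_nonneg hA) hcol (expVec_pos v) i).ne'
  have e1 : ∑ j, A i j * Real.exp (-v j) = (A *ᵥ expVec (-v)) i := rfl
  have e2 : ∑ j, A j i * Real.exp (v j) = (Aᵀ *ᵥ expVec v) i := rfl
  change ∑ j, rateMatrix A v i j * 1 = 1
  simp only [mul_one, rateMatrix_apply hA hrow hcol, ← Finset.mul_sum, Finset.sum_add_distrib,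
    ← Finset.sum_div, e1, e2, div_self h1, div_self h2]
  norm_num

theorem isPrimitive_rateMatrix (hA : ∀ i j, 0 ≤ A i j) (hrow : ∀ i, ∃ j, 0 < A i j)
    (hcol : ∀ i, ∃ j, 0 < Aᵀ i j) (hprim : (A + Aᵀ).IsPrimitive) (v : Fin n → ℝ) :
    (rateMatrix A v).IsPrimitive := by
  have h1 := mulVec_pos hA hrow (expVec_pos (-v))
  have h2 := mulVec_pos (transpose_nonneg hA) hcol (expVec_pos v)
  have ht1 : ∀ i j, 0 ≤ A j i * Real.exp (v j) / (Aᵀ *ᵥ expVec v) i := fun i j =>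
    div_nonneg (mul_nonneg (hA j i) (Real.exp_pos _).le) (h2 i).le
  have ht2 : ∀ i j, 0 ≤ A i j * Real.exp (-v j) / (A *ᵥ expVec (-v)) i := fun i j =>
    div_nonneg (mul_nonneg (hA i j) (Real.exp_pos _).le) (h1 i).le
  have hnonneg : ∀ i j, 0 ≤ rateMatrix A v i j := fun i j => by
    rw [rateMatrix_apply hA hrow hcol]
    exact mul_nonneg (by norm_num) (add_nonneg (ht1 i j) (ht2 i j))
  obtain ⟨k, hk, hpos⟩ := hprim.exists_pos_pow
  refine ⟨hnonneg, k, hk, fun i j =>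
    pow_pos_of_pos_imp hprim.nonneg hnonneg (fun i j hij => ?_) k i j (hpos i j)⟩
  rw [rateMatrix_apply hA hrow hcol]
  refine mul_pos (by norm_num) ?_
  rcases (hA i j).lt_or_eq with h0 | h0
  · exact add_pos_of_nonneg_of_pos (ht1 i j) (div_pos (mul_pos h0 (Real.exp_pos _)) (h1 i))
  · have hT : 0 < A j i := by simpa [← h0] using hij
    exact add_pos_of_pos_of_nonneg (div_pos (mul_pos hT (Real.exp_pos _)) (h2 i)) (ht2 i j)

/-- At a balancing vector, the rate matrix is reversible with respect to the row sums of the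
balanced matrix. -/
theorem rateMatrix_reversible (hA : ∀ i j, 0 ≤ A i j) (hrow : ∀ i, ∃ j, 0 < A i j)
    (hcol : ∀ i, ∃ j, 0 < Aᵀ i j)
    (hv : ∀ i, ∑ j, A i j * Real.exp (v i - v j) = ∑ j, A j i * Real.exp (v j - v i)) :
    ∃ d : Fin n → ℝ, (∀ i, 0 < d i) ∧
      ∀ i j, d i * rateMatrix A v i j = d j * rateMatrix A v j i := by
  have hd : ∀ i, 0 < ∑ j, A i j * Real.exp (v i - v j) := fun i => by
    have h1 := mulVec_pos hA hrow (expVec_pos (-v)) i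
    rw [mulVec_expVec_neg] at h1
    exact pos_of_mul_pos_right h1 (Real.exp_pos _).le
  refine ⟨_, hd, ?_⟩
  have h : ∀ i j, (∑ l, A i l * Real.exp (v i - v l)) * rateMatrix A v i j =
      (1 / 2) * (A j i * Real.exp (v j - v i) + A i j * Real.exp (v i - v j)) := fun i j => by
    have hi := (hd i).ne'
    rw [rateMatrix_apply hA hrow hcol, mulVec_expVec_neg, transpose_mulVec_expVec, ← hv i]
    generalize ∑ l, A i l * Real.exp (v i - v l) = D at hi ⊢
    rw [Real.exp_sub, Real.exp_sub, Real.exp_neg, Real.exp_neg]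
    field_simp
  intro i j
  rw [h, h]
  ring

theorem absLambda2_rateMatrix_lt_one_and_rate (hA : ∀ i j, 0 ≤ A i j) (hrow : ∀ i, ∃ j, 0 < A i j)
    (hcol : ∀ i, ∃ j, 0 < Aᵀ i j) (hprim : (A + Aᵀ).IsPrimitive)
    (hv : ∀ i, ∑ j, A i j * Real.exp (v i - v j) = ∑ j, A j i * Real.exp (v j - v i)) :
    absLambda2 (rateMatrix A v) < 1 ∧ ∀ x : Fin n → ℝ, ∃ c : ℝ,
      Tendsto (fun k => (idealMap A)^[k] x) atTop (𝓝 (v + fun _ => c)) ∧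
      ∀ s > absLambda2 (rateMatrix A v), ∃ D : ℝ, ∀ᶠ k in atTop,
        ‖(idealMap A)^[k] x - (v + fun _ => c)‖ ≤ D * s ^ k := by
  -- Dimension zero is separate: there the spectrum is empty, and the general argument needs a
  -- coordinate.
  rcases n.eq_zero_or_pos with rfl | hn
  · refine ⟨?_, fun x => ⟨0, ?_, fun s _ => ⟨0, ?_⟩⟩⟩
    · have : otherModuli (rateMatrix A v) = ∅ := by
        ext r
        simp [otherModuli, spectrum.of_subsingleton]
      simp [absLambda2, this]
    · exact tendsto_const_nhds.congr fun k => Subsingleton.elim _ _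
    · exact Eventually.of_forall fun k => by
        rw [Subsingleton.elim (_ - _) (0 : Fin 0 → ℝ), norm_zero, zero_mul]
  have : NeZero n := ⟨hn.ne'⟩
  have hf := isTopical_idealMap hA hrow hcol
  have hfix := idealMap_eq_self_of_sum_eq hA hrow hv
  obtain ⟨d, hd, hrev⟩ := rateMatrix_reversible hA hrow hcol hv
  obtain ⟨hlt, q, C, hC, hq1, hq, hqC⟩ := absLambda2_contraction
    (isPrimitive_rateMatrix hA hrow hcol hprim v) (rateMatrix_mulVec_one hA hrow hcol v) hd hrev
  refine ⟨hlt, fun x => ?_⟩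
  obtain ⟨K, -, hK⟩ := hprim.exists_pos_pow
  obtain ⟨c, hc⟩ := hf.exists_tendsto_iterate hfix (K := K) (fun x y hxy hne i => by
    obtain ⟨j, hj⟩ : ∃ j, x j < y j := by
      by_contra! h
      exact hne (le_antisymm hxy h)
    exact iterate_idealMap_lt hA hrow hcol hxy hj K i (hK i j)) x
  exact ⟨c, hc, fun s hs => hf.exists_norm_iterate_sub_le_geometric hfix
    (hasFDerivAt_idealMap hA hrow hcol v) (absLambda2_nonneg _) hq hC hq1 hqC hc hs⟩

theorem idealStep_iterate_expVec (hA : ∀ i j, 0 ≤ A i j) (hrow : ∀ i, ∃ j, 0 < A i j)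
    (hcol : ∀ i, ∃ j, 0 < Aᵀ i j) (x : Fin n → ℝ) (k : ℕ) :
    (idealStep A)^[k] (expVec x) = expVec ((idealMap A)^[k] x) := by
  induction k with
  | zero => rfl
  | succ k ih =>
    rw [Function.iterate_succ_apply', ih, idealStep_expVec hA hrow hcol,
      Function.iterate_succ_apply']

theorem continuous_expVec : Continuous (expVec (n := n)) :=
  continuous_pi fun i => Real.continuous_exp.comp (continuous_apply i)

/-- Carries the geometric rate from `f` through `exp`; the 2 comes from `|exp t - 1| ≤ 2 * |t|` for
`|t| ≤ 1`. -/
theorem norm_expVec_sub_le (l x : Fin n → ℝ) (h : ‖x - l‖ ≤ 1) :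
    ‖expVec x - expVec l‖ ≤ 2 * ‖expVec l‖ * ‖x - l‖ := by
  refine (pi_norm_le_iff_of_nonneg (by positivity)).2 fun i => ?_
  have hi := norm_le_pi_norm (x - l) i
  have heq : (expVec x - expVec l) i = expVec l i * (Real.exp ((x - l) i) - 1) := by
    simp only [expVec, Pi.sub_apply, mul_sub, ← Real.exp_add]
    simp
  rw [heq, norm_mul]
  calc ‖expVec l i‖ * ‖Real.exp ((x - l) i) - 1‖ ≤ ‖expVec l‖ * (2 * ‖(x - l) i‖) := by
        refine mul_le_mul (norm_le_pi_norm _ i) ?_ (norm_nonneg _) (norm_nonneg _)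
        exact Real.abs_exp_sub_one_le (hi.trans h)
    _ ≤ ‖expVec l‖ * (2 * ‖x - l‖) := by gcongr
    _ = _ := by ring

end Balanced

/-! ### Assembly of the theorem -/

theorem limsup_seminorm_rpow_le {n : ℕ} {u : ℕ → Fin n → ℝ} {r : ℝ} (hr : 0 ≤ r)
    (h : ∀ s > r, ∃ D : ℝ, ∀ᶠ k in atTop, ‖u k‖ ≤ D * s ^ k) (N : Seminorm ℝ (Fin n → ℝ)) :
    limsup (fun k : ℕ => ENNReal.ofReal (N (u k)) ^ (1 / (k : ℝ))) atTop ≤ ENNReal.ofReal r := by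
  obtain ⟨E, hE0, hE⟩ := exists_seminorm_le_mul_norm N
  refine limsup_rpow_one_div_le_of_geometric hr fun s hs => ?_
  obtain ⟨D, hD⟩ := h s hs
  refine ⟨E * D, hD.mono fun k hk => (hE _).trans ?_⟩
  rw [mul_assoc]
  exact mul_le_mul_of_nonneg_left hk hE0

end Hots

theorem theorem3p1 (n : ℕ) (A : Matrix (Fin n) (Fin n) ℝ)
    (hA : A.IsIrreducible) (hprim : (A + Aᵀ).IsPrimitive) :
    ∃ v : Fin n → ℝ,
      -- `v` is a fixed point of `f`, and `diag(eᵛ)` balances `A`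
      Hots.idealMap A v = v ∧
      Hots.IsBalanced
        (Matrix.diagonal (Hots.expVec v) * A * (Matrix.diagonal (Hots.expVec v))⁻¹) ∧
      -- `P = ∇f(v)`
      HasFDerivAt (Hots.idealMap A)
        (LinearMap.toContinuousLinearMap (Matrix.toLin' (Hots.rateMatrix A v))) v ∧
      -- every orbit of `f` approaches `v`, up to an additive constant, at rate `|λ₂(P)|`
      (∀ x : Fin n → ℝ, ∃ c : ℝ, ∀ N : Seminorm ℝ (Fin n → ℝ),
        limsup (fun k : ℕ =>
            ENNReal.ofReal (N ((Hots.idealMap A)^[k + 1] x - (v + fun _ => c))) ^ (1 / (k : ℝ)))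
          atTop ≤ ENNReal.ofReal (Hots.absLambda2 (Hots.rateMatrix A v))) ∧
      -- the ideal HOTS algorithm converges linearly at rate `|λ₂(P)|`
      (∀ y : Fin n → ℝ, (∀ i, 0 < y i) → ∃ c : ℝ,
        Hots.ConvergesLinearlyTo (fun k : ℕ => (Hots.idealStep A)^[k] y)
          (Hots.expVec (v + fun _ => c)) (Hots.absLambda2 (Hots.rateMatrix A v))) := by
  have hrow := Hots.exists_pos_entry_of_isIrreducible hA
  have hcol := Hots.exists_pos_entry_of_isIrreducible hA.transpose
  obtain ⟨v, hv⟩ := Hots.exists_balancing hA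
  obtain ⟨hlt, hrate⟩ :=
    Hots.absLambda2_rateMatrix_lt_one_and_rate hA.nonneg hrow hcol hprim hv
  have hr := Hots.absLambda2_nonneg (Hots.rateMatrix A v)
  refine ⟨v, Hots.idealMap_eq_self_of_sum_eq hA.nonneg hrow hv, Hots.isBalanced_of_sum_eq hv,
    Hots.hasFDerivAt_idealMap hA.nonneg hrow hcol v, fun x => ?_, fun y hy => ?_⟩
  · obtain ⟨c, -, hc⟩ := hrate x
    refine ⟨c, Hots.limsup_seminorm_rpow_le hr fun s hs => ?_⟩
    obtain ⟨D, hD⟩ := hc s hs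
    -- The extra factor `s` accounts for the iterate `k + 1` against the root `1 / k`.
    refine ⟨D * s, ((tendsto_add_atTop_nat 1).eventually hD).mono fun k hk => ?_⟩
    rwa [mul_assoc, ← pow_succ']
  · have hy' : y = Hots.expVec fun i => Real.log (y i) := by
      ext i; exact (Real.exp_log (hy i)).symm
    obtain ⟨c, hlim, hc⟩ := hrate fun i => Real.log (y i)
    set x : Fin n → ℝ := fun i => Real.log (y i)
    set l := v + fun _ : Fin n => c
    have hit : ∀ k, (Hots.idealStep A)^[k] y = Hots.expVec ((Hots.idealMap A)^[k] x) := fun k => by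
      rw [hy', Hots.idealStep_iterate_expVec hA.nonneg hrow hcol]
    refine ⟨c, hlt, ?_, Hots.limsup_seminorm_rpow_le hr fun s hs => ?_⟩
    · simp_rw [hit]
      exact (Hots.continuous_expVec.tendsto l).comp hlim
    · obtain ⟨D, hD⟩ := hc s hs
      refine ⟨2 * ‖Hots.expVec l‖ * D, ?_⟩
      filter_upwards [hD, (tendsto_iff_norm_sub_tendsto_zero.1 hlim).eventually
        (ge_mem_nhds zero_lt_one)] with k hk hk1
      rw [hit, mul_assoc (2 * ‖Hots.expVec l‖)]
      exact (Hots.norm_expVec_sub_le l _ hk1).trans (by gcongr)
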